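/- Let $N\cong\mathbb Z^n$ be a lattice, $M=\mathrm{Hom}(N,\mathbb Z)$, and let $\sigma\subseteq N_{\mathbb R}=N\otimes_{\mathbb Z}\mathbb R$ be an $n$-dimensional strongly convex rational polyhedral cone. Let $n_1,\dots,n_s\in N$ be the primitive generators of the one-dimensional faces of $\sigma$. Assume that $\sigma$ is a Gorenstein canonical cone, i.e. there is $m_0\in M$ with $\langle m_0,n_i\rangle=1$ for all $i$ and $\langle m_0,v\rangle\ge 1$ for all $v\in\sigma\cap(N\setminus\{0\})$. Let $P$ be the convex hull of $n_1,\dots,n_s$ (a polytope in the hyperplane $\langle m_0,\cdot\rangle=1$). Suppose given a triangulation of $P$ such that the cones over its simplices, together with $\{0\}$, form a fan $\Sigma$ of rational cones whose toric variety $Y_\Sigma$ over $\mathbb C$ is non-singular. Let $T_{\mathbb C}(N)=N\otimes_{\mathbb Z}\mathbb C^*=\mathrm{Spec}\,\mathbb C[M]\subseteq Y_\Sigma$ be the dense torus (the open subset belonging to the cone $\{0\}$). Let $e_1,\dots,e_n$ be a basis of $N$ whose dual basis $e_1^*,\dots,e_n^*$ satisfies $m_0=e_1^*+\cdots+e_n^*$,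 and let $z_1,\dots,z_n$ be the coordinates on $T_{\mathbb C}(N)$ given by the characters $e_1^*,\dots,e_n^*$. **Proposition 2.1.** If $\Omega$ is a nowhere vanishing regular (algebraic) $n$-form on $Y_\Sigma$, i.e. a nowhere vanishing global section of $\Omega^n_{Y_\Sigma/\mathbb C}$, then there is a constant $C\in\mathbb C$ with $$\Omega|_{T_{\mathbb C}(N)}=C\,dz_1\wedge\cdots\wedge dz_n .$$ -/

import Mathlib

open CategoryTheory CategoryTheory.Limits AlgebraicGeometry
open scoped TensorProduct

noncomputable section

namespace Toric

/-! ### Lattices, cones and faces -/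

section Cones

variable {N : Type} [AddCommGroup N]

/-- The real vector space `N_ℝ = ℝ ⊗ N` attached to a lattice `N`. -/
abbrev RealSpan (N : Type) [AddCommGroup N] : Type := ℝ ⊗[ℤ] N

/-- The image of a lattice vector in `N_ℝ`. -/
abbrev toReal (v : N) : RealSpan N := (1 : ℝ) ⊗ₜ[ℤ] v

/-- The pairing `⟨m, x⟩` of `m ∈ M = Hom(N, ℤ)` with `x ∈ N_ℝ`. -/
abbrev pair (m : Module.Dual ℤ N) (x : RealSpan N) : ℝ := m.baseChange ℝ x

/-- `σ` is a strongly convex rational polyhedral cone: it is generated by finitely many lattice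
vectors and contains no line. -/
structure IsStronglyConvexRational (σ : PointedCone ℝ (RealSpan N)) : Prop where
  rational : ∃ S : Finset N, σ = PointedCone.hull ℝ (toReal '' (S : Set N))
  salient : (σ : ConvexCone ℝ (RealSpan N)).Salient

/-- The monoid `σ^∨ ∩ M` of lattice functionals that are nonnegative on `σ`. -/
def dualMonoid (σ : PointedCone ℝ (RealSpan N)) : AddSubmonoid (Module.Dual ℤ N) where
  carrier := {m | ∀ x ∈ σ, 0 ≤ pair m x}
  zero_mem' := by intro x _; simp [pair]
  add_mem' := by
    intro a b ha hb x hx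
    have := add_nonneg (ha x hx) (hb x hx)
    simpa [pair] using this

/-- `τ` is a face of the rational cone `σ`: `τ = σ ∩ m^⊥` for some `m ∈ σ^∨ ∩ M`. -/
def IsFace (τ σ : PointedCone ℝ (RealSpan N)) : Prop :=
  ∃ m ∈ dualMonoid σ, ∀ x, x ∈ τ ↔ x ∈ σ ∧ pair m x = 0

/-- The generators `n_1, …, n_s ∈ N` of the one-dimensional faces of `σ`: the lattice vectors
`v ≠ 0` such that `ℝ_{≥0} v` is a face of `σ` and `ℝ_{≥0} v ∩ N = ℕ v`. -/
def rayGenerators (σ : PointedCone ℝ (RealSpan N)) : Set N :=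
  {v | v ≠ 0 ∧ IsFace (PointedCone.hull ℝ {toReal v}) σ ∧
    ∀ w : N, toReal w ∈ PointedCone.hull ℝ {toReal v} → ∃ k : ℕ, w = k • v}

/-- `σ` is a Gorenstein canonical cone, as witnessed by `m₀ ∈ M`. -/
structure IsGorensteinCanonical (σ : PointedCone ℝ (RealSpan N)) (m₀ : Module.Dual ℤ N) :
    Prop where
  stronglyConvexRational : IsStronglyConvexRational σ
  apply_rayGenerator : ∀ v ∈ rayGenerators σ, m₀ v = 1
  one_le : ∀ v : N, v ≠ 0 → toReal v ∈ σ → 1 ≤ m₀ v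

/-- The polytope `P`: the convex hull of the generators of the rays of `σ`. -/
def rayPolytope (σ : PointedCone ℝ (RealSpan N)) : Set (RealSpan N) :=
  convexHull ℝ (toReal '' rayGenerators σ)

/-- A fan of strongly convex rational polyhedral cones in `N_ℝ`. It is finite and, as is usual,
nonempty; equivalently, it contains the cone `{0}`. -/
structure Fan (N : Type) [AddCommGroup N] where
  cones : Set (PointedCone ℝ (RealSpan N))
  finite : cones.Finite
  stronglyConvexRational : ∀ σ ∈ cones, IsStronglyConvexRational σ
  zero_mem : ⊥ ∈ cones
  face_mem : ∀ σ ∈ cones, ∀ τ, IsFace τ σ → τ ∈ cones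
  inter_face : ∀ σ ∈ cones, ∀ τ ∈ cones, IsFace (σ ⊓ τ) σ

/-- The fan `Δ` consists of the cones over the simplices of the simplicial complex `K`,
the cone over the empty simplex being `{0}`. -/
def Fan.IsConeOver (Δ : Fan N) (K : Geometry.SimplicialComplex ℝ (RealSpan N)) : Prop :=
  Δ.cones = insert ⊥ {τ | ∃ s ∈ K.faces, τ = PointedCone.hull ℝ (s : Set (RealSpan N))}

lemma dualMonoid_anti {τ σ : PointedCone ℝ (RealSpan N)} (h : τ ≤ σ) :
    dualMonoid σ ≤ dualMonoid τ := fun _ hm x hx => hm x (h hx)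

/-- If the face `τ` of `σ` is cut out by `m`, then `τ^∨ ∩ M = σ^∨ ∩ M + ℕ (-m)`. -/
lemma exists_add_nsmul_mem {τ σ : PointedCone ℝ (RealSpan N)} (hσ : IsStronglyConvexRational σ)
    {m : Module.Dual ℤ N} (hm : m ∈ dualMonoid σ) (h : ∀ x, x ∈ τ ↔ x ∈ σ ∧ pair m x = 0)
    {w : Module.Dual ℤ N} (hw : w ∈ dualMonoid τ) : ∃ k : ℕ, w + k • m ∈ dualMonoid σ := by
  obtain ⟨S, rfl⟩ := hσ.rational
  have hS : ∀ s ∈ S, toReal s ∈ PointedCone.hull ℝ (toReal '' (S : Set N)) := fun s hs =>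
    Submodule.subset_span ⟨s, hs, rfl⟩
  refine ⟨∑ s ∈ S, (w s).natAbs, fun x hx => ?_⟩
  induction hx using Submodule.span_induction with
  | mem x hx =>
    obtain ⟨s, hs, rfl⟩ := hx
    have h1 : (0 : ℝ) ≤ (m s : ℝ) := by simpa [pair] using hm _ (hS s hs)
    have hk : (w s).natAbs ≤ ∑ s ∈ S, (w s).natAbs :=
      Finset.single_le_sum (f := fun s => (w s).natAbs) (fun _ _ => Nat.zero_le _) hs
    generalize ∑ s ∈ S, (w s).natAbs = k at hk
    suffices 0 ≤ w s + k * m s by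
      have h2 : (0 : ℝ) ≤ ((w s + k * m s : ℤ) : ℝ) := by exact_mod_cast this
      simpa [pair] using h2
    have h1' : 0 ≤ m s := by exact_mod_cast h1
    rcases h1'.eq_or_lt with h0 | h0
    · have : toReal s ∈ τ := (h _).2 ⟨hS s hs, by simp [pair, ← h0]⟩
      have h3 : (0 : ℝ) ≤ (w s : ℝ) := by simpa [pair] using hw _ this
      have h3' : 0 ≤ w s := by exact_mod_cast h3
      rw [← h0]; omega
    · have : (k : ℤ) ≤ k * m s := le_mul_of_one_le_right (by omega) h0
      omega
  | zero => simp [pair]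
  | add x y _ _ hx hy =>
    simp only [pair, map_add] at hx hy ⊢
    linarith
  | smul a x _ hx =>
    have : a • x = (a : ℝ) • x := rfl
    simp only [pair] at hx ⊢
    rw [this, map_smul]
    exact mul_nonneg a.2 hx

/-! ### Affine toric varieties -/

/-- The coordinate ring `ℂ[σ^∨ ∩ M]`. -/
abbrev CoordRing (σ : PointedCone ℝ (RealSpan N)) : Type := AddMonoidAlgebra ℂ (dualMonoid σ)

/-- The character `χ^m`, as an element of `ℂ[σ^∨ ∩ M]`. -/
abbrev chi {σ : PointedCone ℝ (RealSpan N)} (m : dualMonoid σ) : CoordRing σ :=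
  AddMonoidAlgebra.single m 1

/-- The inclusion `ℂ[σ^∨ ∩ M] → ℂ[τ^∨ ∩ M]` for `τ ⊆ σ`. -/
def coordMap {τ σ : PointedCone ℝ (RealSpan N)} (h : τ ≤ σ) : CoordRing σ →ₐ[ℂ] CoordRing τ :=
  AddMonoidAlgebra.mapDomainAlgHom ℂ ℂ (AddSubmonoid.inclusion (dualMonoid_anti h))

lemma coordMap_chi {τ σ : PointedCone ℝ (RealSpan N)} (h : τ ≤ σ) (m : dualMonoid σ) :
    coordMap h (chi m) = chi (AddSubmonoid.inclusion (dualMonoid_anti h) m) := by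
  simp [coordMap, chi]

lemma coordMap_self {σ : PointedCone ℝ (RealSpan N)} (h : σ ≤ σ) (x : CoordRing σ) :
    coordMap h x = x := by
  induction x using AddMonoidAlgebra.induction_linear with
  | zero => simp
  | add f g hf hg => rw [map_add, hf, hg]
  | single w a =>
    simp only [coordMap, AddMonoidAlgebra.mapDomainAlgHom_apply, AddMonoidAlgebra.mapDomain_single]
    rfl

lemma coordMap_coordMap {ρ τ σ : PointedCone ℝ (RealSpan N)} (h : ρ ≤ τ) (h' : τ ≤ σ)
    (x : CoordRing σ) : coordMap h (coordMap h' x) = coordMap (h.trans h') x := by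
  induction x using AddMonoidAlgebra.induction_linear with
  | zero => simp
  | add f g hf hg => rw [map_add, map_add, map_add, hf, hg]
  | single w a =>
    simp only [coordMap, AddMonoidAlgebra.mapDomainAlgHom_apply, AddMonoidAlgebra.mapDomain_single]
    rfl

lemma coordMap_injective {τ σ : PointedCone ℝ (RealSpan N)} (h : τ ≤ σ) :
    Function.Injective (coordMap h) :=
  AddMonoidAlgebra.mapDomain_injective (AddSubmonoid.inclusion_injective _)

lemma chi_pow {σ : PointedCone ℝ (RealSpan N)} (m : dualMonoid σ) (k : ℕ) :
    chi m ^ k = chi (k • m) := by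
  simp [chi, AddMonoidAlgebra.single_pow]

/-- If `τ` is the face of `σ` cut out by `m`, then `ℂ[τ^∨ ∩ M]` is the localization of
`ℂ[σ^∨ ∩ M]` at `χ^m`. -/
lemma isLocalization_coordMap {τ σ : PointedCone ℝ (RealSpan N)} (hτσ : τ ≤ σ)
    (hσ : IsStronglyConvexRational σ) {m : Module.Dual ℤ N} (hm : m ∈ dualMonoid σ)
    (h : ∀ x, x ∈ τ ↔ x ∈ σ ∧ pair m x = 0) :
    let := (coordMap hτσ).toRingHom.toAlgebra
    IsLocalization.Away (chi ⟨m, hm⟩ : CoordRing σ) (CoordRing τ) := by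
  let := (coordMap hτσ).toRingHom.toAlgebra
  have halg : ∀ x, algebraMap (CoordRing σ) (CoordRing τ) x = coordMap hτσ x := fun _ => rfl
  refine (isLocalization_iff _ _).2 ⟨?_, ?_, ?_⟩
  · rintro ⟨_, k, rfl⟩
    have hneg : -m ∈ dualMonoid τ := fun x hx => by simp [pair, ((h x).1 hx).2]
    rw [map_pow, halg, coordMap_chi]
    refine IsUnit.pow _ (IsUnit.of_mul_eq_one (chi ⟨-m, hneg⟩) ?_)
    rw [AddMonoidAlgebra.single_mul_single, AddMonoidAlgebra.one_def, one_mul]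
    congr 1
    ext1
    simp
  · have key : ∀ z : CoordRing τ, ∃ k : ℕ, ∃ x : CoordRing σ,
        z * coordMap hτσ (chi ⟨m, hm⟩ ^ k) = coordMap hτσ x := by
      intro z
      induction z using AddMonoidAlgebra.induction_linear with
      | zero => exact ⟨0, 0, by simp⟩
      | add f g hf hg =>
        obtain ⟨k, x, hx⟩ := hf
        obtain ⟨l, y, hy⟩ := hg
        refine ⟨k + l, x * chi ⟨m, hm⟩ ^ l + y * chi ⟨m, hm⟩ ^ k, ?_⟩
        rw [map_add, map_mul, map_mul, ← hx, ← hy, pow_add, map_mul]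
        ring
      | single w a =>
        obtain ⟨k, hk⟩ := exists_add_nsmul_mem hσ hm h w.2
        refine ⟨k, AddMonoidAlgebra.single ⟨_, hk⟩ a, ?_⟩
        rw [chi_pow, coordMap_chi, AddMonoidAlgebra.single_mul_single, mul_one]
        simp only [coordMap, AddMonoidAlgebra.mapDomainAlgHom_apply,
          AddMonoidAlgebra.mapDomain_single]
        rfl
    intro z
    obtain ⟨k, x, hx⟩ := key z
    exact ⟨(x, ⟨_, k, rfl⟩), hx⟩
  · intro x y hxy
    exact ⟨1, by rw [coordMap_injective hτσ hxy]⟩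

end Cones

/-! ### The toric variety of a fan -/

section Variety

variable {N : Type} [AddCommGroup N] (Δ : Fan N)

/-- The base scheme `Spec ℂ`. -/
abbrev SpecC : Scheme.{0} := Spec (CommRingCat.of ℂ)

/-- The diagram of the affine toric varieties `Spec ℂ[τ^∨ ∩ M]`, `τ ∈ Δ`, and the inclusions
`Spec ℂ[τ^∨ ∩ M] ⊆ Spec ℂ[σ^∨ ∩ M]` for `τ ⊆ σ`. -/
def Fan.diagram : Δ.cones ⥤ Scheme.{0} where
  obj τ := Spec (CommRingCat.of (CoordRing τ.1))
  map f := Spec.map (CommRingCat.ofHom (coordMap (leOfHom f)).toRingHom)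
  map_id τ := by
    rw [← Spec.map_id]
    exact congrArg Spec.map (CommRingCat.hom_ext (RingHom.ext fun x => coordMap_self le_rfl x))
  map_comp f g := by
    rw [← Spec.map_comp]
    exact congrArg Spec.map (CommRingCat.hom_ext (RingHom.ext fun x =>
      (coordMap_coordMap (leOfHom f) (leOfHom g) x).symm))

lemma Fan.isFace_of_le {τ σ : Δ.cones} (h : τ ≤ σ) : IsFace τ.1 σ.1 := by
  have := Δ.inter_face σ.1 σ.2 τ.1 τ.2
  rwa [inf_eq_right.2 h] at this

instance {τ σ : Δ.cones} (f : τ ⟶ σ) : IsOpenImmersion (Δ.diagram.map f) := by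
  obtain ⟨m, hm, h⟩ := Δ.isFace_of_le (leOfHom f)
  let := (coordMap (leOfHom f)).toRingHom.toAlgebra
  have := isLocalization_coordMap (leOfHom f) (Δ.stronglyConvexRational _ σ.2) hm h
  exact IsOpenImmersion.of_isLocalization (chi ⟨m, hm⟩)

lemma Fan.mem_range_diagram_map {τ σ : Δ.cones} (f : τ ⟶ σ) {m : Module.Dual ℤ N}
    (hm : m ∈ dualMonoid σ.1) (h : ∀ x, x ∈ τ.1 ↔ x ∈ σ.1 ∧ pair m x = 0)
    (p : PrimeSpectrum (CoordRing σ.1)) :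
    p ∈ Set.range (PrimeSpectrum.comap (coordMap (leOfHom f)).toRingHom) ↔
      chi ⟨m, hm⟩ ∉ p.asIdeal := by
  let := (coordMap (leOfHom f)).toRingHom.toAlgebra
  have := isLocalization_coordMap (leOfHom f) (Δ.stronglyConvexRational _ σ.2) hm h
  have := PrimeSpectrum.localization_away_comap_range (CoordRing τ.1)
    (chi ⟨m, hm⟩ : CoordRing σ.1)
  exact (Set.ext_iff.1 this p)

instance : (Δ.diagram ⋙ Scheme.forget).IsLocallyDirected where
  cond {i j k} fi fj xi xj hx := by
    obtain ⟨mi, hmi, hi⟩ := Δ.isFace_of_le (leOfHom fi)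
    obtain ⟨mj, hmj, hj⟩ := Δ.isFace_of_le (leOfHom fj)
    let l : Δ.cones := ⟨i.1 ⊓ j.1, Δ.face_mem _ i.2 _ (Δ.inter_face _ i.2 _ j.2)⟩
    have hli : l ≤ i := inf_le_left (a := i.1)
    have hlj : l ≤ j := inf_le_right (a := i.1)
    have hl : ∀ x, x ∈ l.1 ↔ x ∈ k.1 ∧ pair (mi + mj) x = 0 := by
      intro x
      have : x ∈ l.1 ↔ x ∈ i.1 ∧ x ∈ j.1 := Iff.rfl
      rw [this, hi, hj]
      have hadd : pair (mi + mj) x = pair mi x + pair mj x := by simp [pair]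
      rw [hadd]
      constructor
      · rintro ⟨⟨h1, h2⟩, -, h3⟩
        exact ⟨h1, by linarith⟩
      · rintro ⟨h1, h2⟩
        have h3 := hmi x h1
        have h4 := hmj x h1
        exact ⟨⟨h1, by linarith⟩, h1, by linarith⟩
    let p : PrimeSpectrum (CoordRing k.1) :=
      PrimeSpectrum.comap (coordMap (leOfHom fi)).toRingHom xi
    have hp' : p = PrimeSpectrum.comap (coordMap (leOfHom fj)).toRingHom xj := hx
    have hpi := (Δ.mem_range_diagram_map fi hmi hi p).1 ⟨xi, rfl⟩
    have hpj := (Δ.mem_range_diagram_map fj hmj hj p).1 ⟨xj, hp'.symm⟩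
    obtain ⟨x, hxp⟩ := (Δ.mem_range_diagram_map (homOfLE hli ≫ fi) (add_mem hmi hmj) hl p).2 (by
      have : (chi ⟨mi + mj, add_mem hmi hmj⟩ : CoordRing k.1) = chi ⟨mi, hmi⟩ * chi ⟨mj, hmj⟩ := by
        rw [AddMonoidAlgebra.single_mul_single, one_mul]
        rfl
      rw [this]
      exact fun hmem => (p.2.mem_or_mem hmem).elim hpi hpj)
    have hx1 : Δ.diagram.map (homOfLE hli ≫ fi) x = p := hxp
    have hx2 : Δ.diagram.map (homOfLE hlj ≫ fj) x = p := hxp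
    refine ⟨l, homOfLE hli, homOfLE hlj, x, ?_, ?_⟩
    · apply (Δ.diagram.map fi).isOpenEmbedding.injective
      rw [Functor.map_comp] at hx1
      exact hx1
    · apply (Δ.diagram.map fj).isOpenEmbedding.injective
      rw [Functor.map_comp] at hx2
      exact hx2.trans hp'

/-- The structure morphisms `Spec ℂ[τ^∨ ∩ M] → Spec ℂ`. -/
def Fan.diagramCocone : Cocone Δ.diagram where
  pt := SpecC
  ι.app τ := Spec.map (CommRingCat.ofHom (algebraMap ℂ (CoordRing τ.1)))
  ι.naturality τ σ f := by
    change Spec.map _ ≫ Spec.map _ = Spec.map _ ≫ 𝟙 _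
    rw [Category.comp_id, ← Spec.map_comp]
    exact congrArg Spec.map (CommRingCat.hom_ext (RingHom.ext fun x =>
      (coordMap (leOfHom f)).commutes x))

/-- The toric variety `Y_Δ`, a scheme over `ℂ`: the affine toric varieties `Spec ℂ[τ^∨ ∩ M]`,
`τ ∈ Δ`, glued along their common faces. -/
def Fan.toricVariety : Over SpecC :=
  Over.mk (colimit.desc Δ.diagram Δ.diagramCocone)

/-- The open immersion `Spec ℂ[τ^∨ ∩ M] → Y_Δ`. -/
def Fan.chart (τ : Δ.cones) : Spec (CommRingCat.of (CoordRing τ.1)) ⟶ Δ.toricVariety.left :=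
  colimit.ι Δ.diagram τ

instance (τ : Δ.cones) : IsOpenImmersion (Δ.chart τ) :=
  inferInstanceAs (IsOpenImmersion (colimit.ι Δ.diagram τ))

/-- The cone `{0}` of a fan. -/
def Fan.zeroCone : Δ.cones := ⟨⊥, Δ.zero_mem⟩

/-- The dense torus `T_ℂ(N) = Spec ℂ[M] ⊆ Y_Δ`, the open subset belonging to the cone `{0}`. -/
def Fan.torus : Δ.toricVariety.left.affineOpens :=
  ⟨Δ.chart Δ.zeroCone ''ᵁ ⊤, (isAffineOpen_top _).image_of_isOpenImmersion _⟩

lemma mem_dualMonoid_bot (m : Module.Dual ℤ N) :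
    m ∈ dualMonoid (⊥ : PointedCone ℝ (RealSpan N)) := by
  intro x hx
  rw [Submodule.mem_bot] at hx
  simp [hx, pair]

/-- The character of `T_ℂ(N)` given by `m ∈ M`, as a regular function on `T_ℂ(N) ⊆ Y_Δ`. -/
def Fan.character (m : Module.Dual ℤ N) : Γ(Δ.toricVariety.left, Δ.torus.1) :=
  ((Scheme.ΓSpecIso (CommRingCat.of (CoordRing Δ.zeroCone.1))).inv ≫
    ((Δ.chart Δ.zeroCone).appIso ⊤).inv) (chi ⟨m, mem_dualMonoid_bot m⟩ : CoordRing Δ.zeroCone.1)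

end Variety

/-! ### Regular differential forms -/

section Forms

/-- The `n`-forms `⋀^n Ω_{A/ℂ}` of a commutative `ℂ`-algebra `A`. -/
abbrev AlgForm (n : ℕ) (A : Type) [CommRing A] [Algebra ℂ A] : Type := ⋀[A]^n Ω[A⁄ℂ]

/-- The form `df_1 ∧ ⋯ ∧ df_n`. -/
def wedgeD {n : ℕ} {A : Type} [CommRing A] [Algebra ℂ A] (f : Fin n → A) : AlgForm n A :=
  exteriorPower.ιMulti A n fun i => KaehlerDifferential.D ℂ A (f i)

/-- The pull-back of forms `g df_1 ∧ ⋯ ∧ df_n ↦ φ(g) dφ(f_1) ∧ ⋯ ∧ dφ(f_n)` along a homomorphism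
`φ : A → B` of `ℂ`-algebras. -/
def AlgForm.map (n : ℕ) {A B : Type} [CommRing A] [CommRing B] [Algebra ℂ A] [Algebra ℂ B]
    (φ : A →ₐ[ℂ] B) : AlgForm n A →+ AlgForm n B :=
  letI : Algebra A B := φ.toRingHom.toAlgebra
  haveI : IsScalarTower ℂ A B := IsScalarTower.of_algebraMap_eq fun x => (φ.commutes x).symm
  letI f : Ω[A⁄ℂ] [⋀^Fin n]→ₗ[A] AlgForm n B :=
    { toFun := fun v => exteriorPower.ιMulti B n fun i => KaehlerDifferential.map ℂ ℂ A B (v i)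
      map_update_add' := by
        intro _ v i x y
        have hc : ∀ (u : Ω[A⁄ℂ]), (fun j =>
            KaehlerDifferential.map ℂ ℂ A B (Function.update v i u j)) =
            Function.update (fun j => KaehlerDifferential.map ℂ ℂ A B (v j)) i
              (KaehlerDifferential.map ℂ ℂ A B u) := by
          intro u
          funext j
          exact Function.apply_update (fun _ => KaehlerDifferential.map ℂ ℂ A B) v i u j
        rw [hc, hc, hc, map_add, AlternatingMap.map_update_add]
      map_update_smul' := by
        intro _ v i c x
        have hc : ∀ (u : Ω[A⁄ℂ]), (fun j =>
            KaehlerDifferential.map ℂ ℂ A B (Function.update v i u j)) =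
            Function.update (fun j => KaehlerDifferential.map ℂ ℂ A B (v j)) i
              (KaehlerDifferential.map ℂ ℂ A B u) := by
          intro u
          funext j
          exact Function.apply_update (fun _ => KaehlerDifferential.map ℂ ℂ A B) v i u j
        rw [hc, hc, map_smul, ← algebraMap_smul B c, AlternatingMap.map_update_smul,
          algebraMap_smul]
      map_eq_zero_of_eq' := by
        intro v i j hij hne
        exact (exteriorPower.ιMulti B n).map_eq_zero_of_eq _ (by simp [hij]) hne }
  (exteriorPower.alternatingMapLinearEquiv f).toAddMonoidHom

variable (X : Over SpecC)

lemma le_preimage_top (U : X.left.Opens) : U ≤ X.hom ⁻¹ᵁ ⊤ := by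
  rw [Scheme.Hom.preimage_top]
  exact le_top

/-- The regular functions on an open subset of a scheme over `ℂ` form a `ℂ`-algebra. -/
instance sectionsAlgebra (U : X.left.Opens) : Algebra ℂ Γ(X.left, U) :=
  ((Scheme.ΓSpecIso (CommRingCat.of ℂ)).inv ≫ X.hom.appLE ⊤ U (le_preimage_top X U)).hom.toAlgebra

/-- Restriction of regular functions to a smaller open subset. -/
def resAlgHom {U V : X.left.Opens} (h : V ≤ U) : Γ(X.left, U) →ₐ[ℂ] Γ(X.left, V) :=
  { (X.left.presheaf.map (homOfLE h).op).hom with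
    commutes' := by
      intro c
      change ((X.hom.appLE ⊤ U (le_preimage_top X U)) ≫ X.left.presheaf.map (homOfLE h).op)
        ((Scheme.ΓSpecIso (CommRingCat.of ℂ)).inv c) = _
      rw [Scheme.Hom.appLE_map]
      rfl }

/-- A global section of `Ω^n_{X/ℂ} = ⋀^n Ω_{X/ℂ}`, that is, a regular `n`-form on `X`: a form in
`⋀^n Ω_{Γ(X,U)/ℂ}` on each affine open subset `U`, compatibly with restrictions. -/
structure RegularForm (n : ℕ) where
  form : ∀ U : X.left.affineOpens, AlgForm n Γ(X.left, U.1)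
  res : ∀ (U V : X.left.affineOpens) (h : V.1 ≤ U.1),
    AlgForm.map n (resAlgHom X h) (form U) = form V

variable {X}

/-- The form `ω` vanishes nowhere: its value in the fibre `κ(p) ⊗ Ω^n` at each point `p` of each
affine open subset is nonzero. -/
def RegularForm.NowhereVanishing {n : ℕ} (ω : RegularForm X n) : Prop :=
  ∀ (U : X.left.affineOpens) (p : PrimeSpectrum Γ(X.left, U.1)),
    (1 : p.asIdeal.ResidueField) ⊗ₜ[Γ(X.left, U.1)] ω.form U ≠ 0

end Forms

end Toric

end

noncomputable section

namespace Toric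


/-! ### Lattice vectors, cones and rational half-spaces -/

section Cones

variable {N : Type} [AddCommGroup N]

/-! On the torus the form is `g dz_1 ∧ ⋯ ∧ dz_n`, and nonvanishing makes `g` a unit of the Laurent
ring, so `g = c χ^k` (`exists_eq_single_of_isUnit`). It remains to show `k = 0`, and for this it is
enough to look along the ray of each ray generator `v`.

The point `v` is a vertex of the triangulation (`IsGorensteinCanonical.singleton_mem_faces`), so its
ray is a cone of the fan. Since `v` is primitive, it extends to a basis `b` of the lattice. The
chart of the ray is an affine line times a torus, with coordinates the characters dual to `b`. There
the form is again a unit times the wedge of their differentials (`RegularForm.exists_form_chart`).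
That unit is `c' χ^{k'}`, and `k'` vanishes on `v` because both `k'` and `-k'` are nonnegative
there.

On the torus a wedge of differentials of characters is the character of the sum of the exponents
times a wedge of logarithmic differentials. Contracting with invariant vector fields
(`exponents_eq_of_smul_wedgeD_eq`) gives `k + m₀ = k' + ∑ b_i^*`. At `v` both `m₀` and `∑ b_i^*`
equal 1, hence `k v = 0`. As the cone is full-dimensional, its ray generators span, and `k = 0`
(`IsGorensteinCanonical.eq_zero_of_rayGenerators`). -/

lemma pair_toReal (m : Module.Dual ℤ N) (v : N) : pair m (toReal v) = m v := by
  simp [pair, toReal]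

lemma pair_nonneg_of_mem_hull {m : Module.Dual ℤ N} {S : Set (RealSpan N)}
    (h : ∀ x ∈ S, 0 ≤ pair m x) {x : RealSpan N} (hx : x ∈ PointedCone.hull ℝ S) :
    0 ≤ pair m x := by
  induction hx using Submodule.span_induction with
  | mem x hx => exact h x hx
  | zero => simp [pair]
  | add x y _ _ hx hy =>
    have : pair m (x + y) = pair m x + pair m y := map_add _ _ _
    linarith
  | smul a x _ hx =>
    have : pair m (a • x) = (a : ℝ) * pair m x := map_smul (m.baseChange ℝ) (a : ℝ) x
    rw [this]
    exact mul_nonneg a.2 hx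

lemma smul_mem_cone {σ : PointedCone ℝ (RealSpan N)} {x : RealSpan N} (hx : x ∈ σ) {a : ℝ}
    (ha : 0 ≤ a) : a • x ∈ σ :=
  Submodule.smul_mem σ (⟨a, ha⟩ : {r : ℝ // 0 ≤ r}) hx

lemma mem_dualMonoid_hull_singleton {v : N} {m : Module.Dual ℤ N} :
    m ∈ dualMonoid (PointedCone.hull ℝ {toReal v}) ↔ 0 ≤ m v := by
  constructor
  · intro h
    have := h _ (Submodule.mem_span_singleton_self (toReal v))
    rw [pair_toReal] at this
    exact_mod_cast this
  · intro h x hx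
    refine pair_nonneg_of_mem_hull ?_ hx
    rintro _ rfl
    rw [pair_toReal]
    exact_mod_cast h

/-- A vector of a lattice that is divisible only by units is part of a basis. -/
lemma exists_basis_of_primitive {n : ℕ} (e : Module.Basis (Fin n) ℤ N) {v : N}
    (hprim : ∀ (d : ℤ) (w : N), v = d • w → IsUnit d) :
    ∃ (b : Module.Basis (Fin n) ℤ N) (i : Fin n), b i = v := by
  have : Module.Free ℤ N := .of_basis e
  have : Module.Finite ℤ N := .of_basis e
  -- The values at `v` of all functionals form an ideal `(d)`. Since `d` divides every coordinate of
  -- `v`, primitivity makes it a unit, so some `u` has `u v = 1` and the lattice splits as `ℤ v ⊕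
  -- ker u`.
  obtain ⟨d, hd⟩ := (IsPrincipalIdealRing.principal
    (LinearMap.range (Module.Dual.eval ℤ N v) : Ideal ℤ)).principal
  have hmem : ∀ i, ∃ c : ℤ, e.coord i v = d * c := fun i => by
    have : e.coord i v ∈ LinearMap.range (Module.Dual.eval ℤ N v) := ⟨e.coord i, rfl⟩
    rw [hd, Submodule.mem_span_singleton] at this
    obtain ⟨c, hc⟩ := this
    exact ⟨c, by rw [← hc, smul_eq_mul, mul_comm]⟩
  choose c hc using hmem
  have hvd : v = d • ∑ i, c i • e i := by
    rw [Finset.smul_sum]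
    conv_lhs => rw [← e.sum_repr v]
    refine Finset.sum_congr rfl fun i _ => ?_
    rw [smul_smul, ← hc]
    rfl
  have htop : (LinearMap.range (Module.Dual.eval ℤ N v) : Ideal ℤ) = ⊤ := by
    rw [hd]
    exact Ideal.span_singleton_eq_top.2 (hprim d _ hvd)
  obtain ⟨u, hu⟩ : (1 : ℤ) ∈ LinearMap.range (Module.Dual.eval ℤ N v) := by
    rw [htop]; trivial
  replace hu : u v = 1 := hu
  obtain ⟨k, b'⟩ := Submodule.basisOfPid e (LinearMap.ker u)
  let b₁ : Module.Basis (Fin (k + 1)) ℤ N := Module.Basis.mkFinCons v b'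
    (fun c x hx h => by
      have := congrArg u h
      simpa [hu, LinearMap.mem_ker.1 hx] using this)
    (fun z => ⟨-u z, by simp [hu]⟩)
  have hk : k + 1 = n := by
    have h1 := Module.finrank_eq_card_basis b₁
    have h2 := Module.finrank_eq_card_basis e
    simp only [Fintype.card_fin] at h1 h2
    omega
  refine ⟨b₁.reindex (finCongr hk), finCongr hk 0, ?_⟩
  simp [b₁]

/-- A nonzero vector of a lattice is a positive multiple of one that is divisible only by
units. -/
lemma exists_primitive {n : ℕ} (e : Module.Basis (Fin n) ℤ N) {s : N} (hs : s ≠ 0) :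
    ∃ (v : N) (d : ℕ), 0 < d ∧ s = d • v ∧ ∀ (c : ℤ) (w : N), v = c • w → IsUnit c := by
  have : Module.Free ℤ N := .of_basis e
  obtain ⟨i, hi⟩ : ∃ i, e.repr s i ≠ 0 := by
    by_contra! h
    exact hs (e.repr.map_eq_zero_iff.1 (Finsupp.ext h))
  -- Descent on a nonzero coordinate: among all `v` with `s` a positive multiple of `v`, take one
  -- whose `i`-th coordinate has least absolute value.
  have hex : ∃ k : ℕ, ∃ v : N, ∃ d : ℕ, 0 < d ∧ s = d • v ∧ (e.repr v i).natAbs = k :=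
    ⟨_, s, 1, one_pos, by simp, rfl⟩
  classical
  obtain ⟨v, d, hd, hsv, hk⟩ := Nat.find_spec hex
  have hvi : e.repr v i ≠ 0 := by
    rintro h
    rw [hsv] at hi
    simp [h] at hi
  refine ⟨v, d, hd, hsv, fun c w hw => ?_⟩
  have hc0 : c ≠ 0 := by
    rintro rfl
    rw [hw] at hvi
    simp at hvi
  have hrep : e.repr v i = c * e.repr w i := by rw [hw]; simp
  have key : (e.repr v i).natAbs ≤ (e.repr w i).natAbs := by
    rw [hk]
    rcases lt_or_gt_of_ne hc0 with h | h
    · refine Nat.find_min' hex ⟨-w, d * c.natAbs, Nat.mul_pos hd (by omega), ?_, by simp⟩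
      rw [hsv, hw, ← natCast_zsmul, ← natCast_zsmul, smul_smul, smul_neg, ← neg_smul]
      congr 1
      push_cast
      rw [abs_of_neg h]; ring
    · refine Nat.find_min' hex ⟨w, d * c.natAbs, Nat.mul_pos hd (by omega), ?_, rfl⟩
      rw [hsv, hw, ← natCast_zsmul, ← natCast_zsmul, smul_smul]
      congr 1
      push_cast
      rw [abs_of_pos h]
  rw [hrep, Int.natAbs_mul] at key
  have hw0 : 0 < (e.repr w i).natAbs := by
    refine Int.natAbs_pos.2 fun h => hvi ?_
    rw [hrep, h, mul_zero]
  have : c.natAbs ≤ 1 := by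
    by_contra! h
    nlinarith
  exact Int.isUnit_iff_natAbs_eq.2 (by have := Int.natAbs_pos.2 hc0; omega)

/-- If `v = c w` with `c > 0`, then `w` lies on the ray of `v`, hence `w = k v` and `c k = 1`. A
negative factor is handled by changing both signs. -/
lemma rayGenerator_primitive {σ : PointedCone ℝ (RealSpan N)} {v : N} [Module.Free ℤ N]
    (hv : v ∈ rayGenerators σ) (d : ℤ) (w : N) (h : v = d • w) : IsUnit d := by
  obtain ⟨hv0, -, hp⟩ := hv
  have hd0 : d ≠ 0 := by
    rintro rfl
    simp [h] at hv0
  have key : ∀ (c : ℤ) (w : N), 0 < c → v = c • w → IsUnit c := by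
    intro c w hc hcw
    have hmem : toReal w ∈ PointedCone.hull ℝ {toReal v} := by
      have h1 : toReal w = (c : ℝ)⁻¹ • toReal v := by
        have hc' : (c : ℝ) ≠ 0 := by exact_mod_cast hc.ne'
        have h2 : toReal v = (c : ℝ) • toReal w := by
          rw [hcw]
          simp only [toReal]
          rw [TensorProduct.tmul_smul, Int.cast_smul_eq_zsmul]
        rw [h2, smul_smul, inv_mul_cancel₀ hc', one_smul]
      rw [h1]
      exact smul_mem_cone (Submodule.mem_span_singleton_self _) (by positivity)
    obtain ⟨k, hk⟩ := hp w hmem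
    have h3 : (1 - c * k) • v = 0 := by
      rw [sub_smul, one_smul, mul_smul, natCast_zsmul, ← hk, ← hcw, sub_self]
    have h4 := (smul_eq_zero.1 h3).resolve_right hv0
    exact IsUnit.of_mul_eq_one (k : ℤ) (by linarith)
  rcases lt_or_gt_of_ne hd0 with hneg | hpos
  · have := key (-d) (-w) (by omega) (by simpa using h)
    simpa using this
  · exact key d w hpos h

/-- Finitely many lattice points whose convex hull does not contain the origin lie in an open
rational half-space. -/
lemma exists_int_pos {ι : Type*} [Fintype ι] (T : Finset (ι → ℤ))
    (h : (0 : ι → ℝ) ∉ convexHull ℝ ((fun t : ι → ℤ => fun i => (t i : ℝ)) '' (T : Set (ι → ℤ)))) :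
    ∃ c : ι → ℤ, ∀ t ∈ T, 0 < ∑ i, c i * t i := by
  classical
  obtain ⟨f, u, h0, hf⟩ := geometric_hahn_banach_point_closed (convex_convexHull ℝ _)
    ((T.finite_toSet.image _).isCompact_convexHull ℝ).isClosed h
  rw [map_zero] at h0
  -- Being positive on finitely many points is an open condition. Separation from the origin
  -- provides a real solution, so density provides a rational one.
  let O : Set (ι → ℝ) := ⋂ t ∈ T, {c : ι → ℝ | 0 < ∑ i, c i * (t i : ℝ)}
  have hO : IsOpen O := isOpen_biInter_finset fun t _ =>
    isOpen_lt continuous_const (by fun_prop)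
  have hne : O.Nonempty := by
    refine ⟨fun i => f (Pi.single i 1), Set.mem_iInter₂.2 fun t ht => ?_⟩
    have h1 := hf _ (subset_convexHull ℝ _ ⟨t, ht, rfl⟩)
    rw [← ContinuousLinearMap.coe_coe, LinearMap.pi_apply_eq_sum_univ] at h1
    change 0 < ∑ i, f (Pi.single i 1) * (t i : ℝ)
    refine h0.trans (h1.trans_le (Finset.sum_le_sum fun i _ => ?_))
    simp only [smul_eq_mul]
    rw [mul_comm]
    have : (Pi.single i (1 : ℝ) : ι → ℝ) = fun j => if i = j then 1 else 0 := by
      funext j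
      simp [Pi.single_apply, eq_comm]
    rw [this]
    rfl
  obtain ⟨q, hq⟩ := (DenseRange.piMap fun _ : ι => Rat.denseRange_cast (𝕜 := ℝ)).exists_mem_open
    hO hne
  obtain ⟨d, hd⟩ := IsLocalization.exist_integer_multiples (nonZeroDivisors ℤ) Finset.univ q
  choose! c hc using hd
  have hd0 : (d : ℤ) ≠ 0 := nonZeroDivisors.ne_zero d.2
  -- Here `c i = d * q i`, and the sign of the denominator `d` is unknown; the extra factor turns
  -- the scaling into `d ^ 2 > 0`.
  refine ⟨fun i => d * c i, fun t ht => ?_⟩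
  have h1 : 0 < ∑ i, (q i : ℝ) * (t i : ℝ) := (Set.mem_iInter₂.1 hq t ht)
  have h2 : ∀ i, (c i : ℚ) = d * q i := fun i => by
    have := hc i (Finset.mem_univ i)
    rwa [zsmul_eq_mul] at this
  have h3 : ((∑ i, d * c i * t i : ℤ) : ℝ) = (d : ℝ) ^ 2 * ∑ i, (q i : ℝ) * (t i : ℝ) := by
    push_cast
    rw [Finset.mul_sum]
    refine Finset.sum_congr rfl fun i _ => ?_
    have : (c i : ℝ) = d * q i := by exact_mod_cast congrArg (fun x : ℚ => (x : ℝ)) (h2 i)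
    rw [this]; ring
  have h4 : (0 : ℝ) < ((∑ i, d * c i * t i : ℤ) : ℝ) := by
    rw [h3]
    have : (d : ℝ) ≠ 0 := by exact_mod_cast hd0
    positivity
  exact_mod_cast h4

end Cones


/-! ### Ray generators: they span, and they are vertices of the triangulation -/

section Rays

variable {N : Type} [AddCommGroup N]

lemma eq_smul_of_repr_eq_zero {n : ℕ} (b : Module.Basis (Fin n) ℤ N) (i₀ : Fin n) {x : RealSpan N}
    (h : ∀ i, i ≠ i₀ → (b.baseChange ℝ).repr x i = 0) :
    x = (b.baseChange ℝ).repr x i₀ • toReal (b i₀) := by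
  conv_lhs => rw [← (b.baseChange ℝ).sum_repr x]
  rw [Finset.sum_eq_single i₀ (fun i _ hi => by rw [h i hi, zero_smul]) (by simp)]
  simp

lemma mem_hull_singleton_basis {n : ℕ} (b : Module.Basis (Fin n) ℤ N) (i₀ : Fin n) {w : N}
    (h : toReal w ∈ PointedCone.hull ℝ {toReal (b i₀)}) : ∃ k : ℕ, w = k • b i₀ := by
  obtain ⟨⟨a, ha⟩, hw⟩ := Submodule.mem_span_singleton.1 h
  replace hw : a • toReal (b i₀) = toReal w := hw
  have hr : ∀ i, (b.repr w i : ℝ) = a * (b.repr (b i₀) i : ℝ) := fun i => by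
    have := congrArg (fun x => (b.baseChange ℝ).repr x i) hw
    simpa using this.symm
  have hi : a = (b.repr w i₀ : ℝ) := by simpa using (hr i₀).symm
  have h0 : 0 ≤ b.repr w i₀ := by
    rw [hi] at ha
    exact_mod_cast ha
  refine ⟨(b.repr w i₀).toNat, b.repr.injective (Finsupp.ext fun i => ?_)⟩
  have := hr i
  rw [hi] at this
  rw [map_nsmul, ← natCast_zsmul, Int.toNat_of_nonneg h0]
  exact_mod_cast this

/-- The projection of `N_ℝ` along a basis vector. -/
def projAlong {n : ℕ} (b : Module.Basis (Fin n) ℤ N) (i₀ : Fin n) :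
    RealSpan N →ₗ[ℝ] (Fin n → ℝ) :=
  LinearMap.pi fun i => if i = i₀ then 0 else (b.baseChange ℝ).coord i

/-- After projection along `b i₀` the hypothesis says that the hull of `T` misses the origin, so
`exists_int_pos` applies; the functional found is pulled back. In `exists_rayGenerator` it cuts out
the ray of `b i₀`. -/
lemma exists_dual_pos {n : ℕ} (b : Module.Basis (Fin n) ℤ N) (i₀ : Fin n) (T : Finset N)
    (h : ∀ y ∈ convexHull ℝ (toReal '' (T : Set N)), ∀ a : ℝ, y ≠ a • toReal (b i₀)) :
    ∃ m : Module.Dual ℤ N, m (b i₀) = 0 ∧ ∀ t ∈ T, 0 < m t := by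
  classical
  let q : N → Fin n → ℤ := fun t i => if i = i₀ then 0 else b.repr t i
  have hq : (fun t : Fin n → ℤ => fun i => (t i : ℝ)) '' (T.image q : Finset (Fin n → ℤ)) =
      projAlong b i₀ '' (toReal '' (T : Set N)) := by
    rw [Finset.coe_image, Set.image_image, Set.image_image]
    refine Set.image_congr fun t _ => funext fun i => ?_
    by_cases hi : i = i₀ <;> simp [q, projAlong, hi]
  obtain ⟨c, hc⟩ := exists_int_pos (T.image q) (by
    rw [hq, ← LinearMap.image_convexHull]
    rintro ⟨y, hy, hy0⟩
    refine h y hy _ (eq_smul_of_repr_eq_zero b i₀ fun i hi => ?_)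
    simpa [projAlong, hi] using congrFun hy0 i)
  refine ⟨∑ i, if i = i₀ then 0 else c i • b.coord i, ?_, fun t ht => ?_⟩
  · rw [LinearMap.sum_apply]
    refine Finset.sum_eq_zero fun i _ => ?_
    by_cases hi : i = i₀
    · simp [hi]
    · simp [hi]
  · have := hc (q t) (Finset.mem_image_of_mem q ht)
    rw [LinearMap.sum_apply]
    refine this.trans_le (Finset.sum_le_sum fun i _ => ?_)
    by_cases hi : i = i₀ <;> simp [q, hi]

lemma pair_add (m : Module.Dual ℤ N) (x y : RealSpan N) : pair m (x + y) = pair m x + pair m y :=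
  map_add (Module.Dual.baseChange ℝ m) x y

lemma pair_smul (m : Module.Dual ℤ N) (a : ℝ) (x : RealSpan N) :
    pair m (a • x) = a * pair m x :=
  map_smul (Module.Dual.baseChange ℝ m) a x

lemma eq_zero_of_pair_eq_zero {m : Module.Dual ℤ N} {T : Set N} (hm : ∀ t ∈ T, 0 < m t)
    {y : RealSpan N} (hy : y ∈ PointedCone.hull ℝ (toReal '' T)) (h0 : pair m y = 0) : y = 0 := by
  have hT : ∀ x ∈ toReal '' T, 0 ≤ pair m x := by
    rintro _ ⟨t, ht, rfl⟩
    rw [pair_toReal]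
    exact_mod_cast (hm t ht).le
  induction hy using Submodule.span_induction with
  | mem x hx =>
    obtain ⟨t, ht, rfl⟩ := hx
    rw [pair_toReal] at h0
    have := hm t ht
    have h1 : m t = 0 := by exact_mod_cast h0
    omega
  | zero => rfl
  | add x y hx hy ihx ihy =>
    have h1 := pair_nonneg_of_mem_hull hT hx
    have h2 := pair_nonneg_of_mem_hull hT hy
    rw [pair_add] at h0
    rw [ihx (by linarith), ihy (by linarith), add_zero]
  | smul a x hx ih =>
    have h1 : pair m ((a : ℝ) • x) = 0 := h0
    rw [pair_smul] at h1
    rcases mul_eq_zero.1 h1 with h | h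
    · rw [show a = 0 from Subtype.ext h, zero_smul]
    · rw [ih h]
      exact smul_zero (a : ℝ)

lemma convexHull_subset_hull (S : Set (RealSpan N)) :
    convexHull ℝ S ⊆ (PointedCone.hull ℝ S : Set (RealSpan N)) :=
  convexHull_min Submodule.subset_span (PointedCone.hull ℝ S).toConvexCone.convex

/-- An irredundant generator of a cone on which some functional is positive spans a ray. -/
lemma exists_rayGenerator {n : ℕ} (e : Module.Basis (Fin n) ℤ N) {σ : PointedCone ℝ (RealSpan N)}
    {T : Finset N} {s : N} (hσ : σ = PointedCone.hull ℝ (insert (toReal s) (toReal '' (T : Set N))))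
    (hs : toReal s ∉ PointedCone.hull ℝ (toReal '' (T : Set N))) {m₀ : Module.Dual ℤ N}
    (hm₀s : 0 < m₀ s) (hm₀ : ∀ t ∈ T, 0 < m₀ t) : ∃ v ∈ rayGenerators σ, ∃ d : ℕ, s = d • v := by
  have hs0 : s ≠ 0 := by
    rintro rfl
    simp at hm₀s
  obtain ⟨v, d, hd, hsv, hprim⟩ := exists_primitive e hs0
  obtain ⟨b, i₀, rfl⟩ := exists_basis_of_primitive e hprim
  have hsr : toReal s = (d : ℝ) • toReal (b i₀) := by
    rw [hsv]
    simp only [toReal]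
    rw [TensorProduct.tmul_smul, Nat.cast_smul_eq_nsmul]
  have hd' : (0 : ℝ) < d := by exact_mod_cast hd
  have hvs : toReal (b i₀) = (d : ℝ)⁻¹ • toReal s := by
    rw [hsr, smul_smul, inv_mul_cancel₀ hd'.ne', one_smul]
  have hm₀v : 0 < pair m₀ (toReal (b i₀)) := by
    rw [hvs, pair_smul, pair_toReal]
    have : (0 : ℝ) < m₀ s := by exact_mod_cast hm₀s
    positivity
  have hsσ : toReal s ∈ σ := hσ ▸ Submodule.subset_span (Set.mem_insert _ _)
  -- Were the hull of `T` to meet the line of `b i₀`, positivity of `m₀` would make the common point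
  -- a positive multiple of `b i₀`, so `s` would be redundant.
  obtain ⟨m, hmv, hmT⟩ := exists_dual_pos b i₀ T (by
    rintro y hy a rfl
    have h1 := convexHull_subset_hull _ hy
    have h2 : 0 < pair m₀ (a • toReal (b i₀)) := by
      have hsub : convexHull ℝ (toReal '' (T : Set N)) ⊆ {x | 0 < pair m₀ x} := by
        refine convexHull_min ?_
          (convex_halfSpace_gt (Module.Dual.baseChange ℝ m₀).isLinear 0)
        rintro _ ⟨t, ht, rfl⟩
        change 0 < pair m₀ (toReal t)
        rw [pair_toReal]
        exact_mod_cast hm₀ t ht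
      exact hsub hy
    rw [pair_smul] at h2
    have ha : 0 < a := pos_of_mul_pos_left h2 hm₀v.le
    refine hs ?_
    have h3 : toReal s = (d * a⁻¹ : ℝ) • a • toReal (b i₀) := by
      rw [smul_smul, mul_assoc, inv_mul_cancel₀ ha.ne', mul_one, hsr]
    rw [h3]
    exact smul_mem_cone h1 (by positivity))
  have hms : m s = 0 := by rw [hsv, map_nsmul, hmv, smul_zero]
  refine ⟨b i₀, ⟨?_, ⟨m, ?_, fun x => ⟨fun hx => ?_, fun hx => ?_⟩⟩,
    fun w hw => mem_hull_singleton_basis b i₀ hw⟩, d, hsv⟩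
  · intro h
    rw [h] at hsv
    exact hs0 (by rw [hsv, smul_zero])
  · intro x hx
    rw [hσ] at hx
    refine pair_nonneg_of_mem_hull ?_ hx
    rintro _ (rfl | ⟨t, ht, rfl⟩)
    · rw [pair_toReal, hms]; simp
    · rw [pair_toReal]
      exact_mod_cast (hmT t ht).le
  · obtain ⟨⟨a, ha⟩, rfl⟩ := Submodule.mem_span_singleton.1 hx
    constructor
    · refine smul_mem_cone ?_ ha
      rw [hvs]
      exact smul_mem_cone hsσ (by positivity)
    · change pair m (a • toReal (b i₀)) = 0
      rw [pair_smul, pair_toReal, hmv]; simp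
  · obtain ⟨hxσ, hx0⟩ := hx
    rw [hσ] at hxσ
    obtain ⟨a, z, hz, rfl⟩ := Submodule.mem_span_insert.1 hxσ
    have h1 : pair m ((a : ℝ) • toReal s + z) = 0 := hx0
    rw [pair_add, pair_smul, pair_toReal, hms] at h1
    have hz0 : z = 0 := eq_zero_of_pair_eq_zero hmT hz (by simpa using h1)
    rw [hz0, add_zero]
    change (a : ℝ) • toReal s ∈ _
    rw [hsr, smul_smul]
    exact smul_mem_cone (Submodule.mem_span_singleton_self _) (mul_nonneg a.2 hd'.le)

/-- The rays of a full-dimensional Gorenstein canonical cone span the lattice rationally. -/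
lemma IsGorensteinCanonical.eq_zero_of_rayGenerators {n : ℕ} (e : Module.Basis (Fin n) ℤ N)
    {σ : PointedCone ℝ (RealSpan N)} {m₀ : Module.Dual ℤ N} (hσ : IsGorensteinCanonical σ m₀)
    (hfull : Submodule.span ℝ (σ : Set (RealSpan N)) = ⊤) {m : Module.Dual ℤ N}
    (hm : ∀ v ∈ rayGenerators σ, m v = 0) : m = 0 := by
  classical
  -- A generating set of least cardinality is irredundant, so each of its members is a multiple of a
  -- ray generator.
  have hex : ∃ k : ℕ, ∃ S : Finset N, S.card = k ∧
      σ = PointedCone.hull ℝ (toReal '' (S : Set N)) := by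
    obtain ⟨S, hS⟩ := hσ.stronglyConvexRational.rational
    exact ⟨_, S, rfl, hS⟩
  obtain ⟨S, hcard, hS⟩ := Nat.find_spec hex
  have hirr : ∀ s ∈ S, toReal s ∉ PointedCone.hull ℝ (toReal '' (S.erase s : Set N)) := by
    intro s hs hmem
    have hle : PointedCone.hull ℝ (toReal '' (S : Set N)) =
        PointedCone.hull ℝ (toReal '' (S.erase s : Set N)) := by
      refine le_antisymm (Submodule.span_le.2 ?_)
        (Submodule.span_mono (Set.image_mono (by simp)))
      rintro _ ⟨t, ht, rfl⟩
      by_cases hts : t = s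
      · exact hts ▸ hmem
      · exact Submodule.subset_span ⟨t, by simpa [hts] using ht, rfl⟩
    have h1 := Nat.find_min' hex ⟨S.erase s, rfl, by simpa [hS] using hle⟩
    have h2 := Finset.card_erase_lt_of_mem hs
    omega
  have hmem : ∀ s ∈ S, toReal s ∈ σ := fun s hs => hS ▸ Submodule.subset_span ⟨s, hs, rfl⟩
  have hpos : ∀ s ∈ S, 0 < m₀ s := fun s hs => by
    have := hσ.one_le s (by
      rintro rfl
      exact hirr 0 hs (by simp [toReal])) (hmem s hs)
    omega
  have hzero : ∀ s ∈ S, m s = 0 := by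
    intro s hs
    obtain ⟨v, hv, d, hd⟩ := exists_rayGenerator e (σ := σ) (T := S.erase s) (s := s) (by
        rw [hS, ← Set.image_insert_eq]
        congr 2
        rw [← Finset.coe_insert, Finset.insert_erase hs]) (hirr s hs) (hpos s hs)
      (fun t ht => hpos t (Finset.mem_of_mem_erase ht))
    rw [hd, map_nsmul, hm v hv, smul_zero]
  have hker : (⊤ : Submodule ℝ (RealSpan N)) ≤ LinearMap.ker (Module.Dual.baseChange ℝ m) := by
    rw [← hfull, Submodule.span_le]
    intro x hx
    rw [SetLike.mem_coe, hS] at hx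
    have h1 : 0 ≤ pair m x := pair_nonneg_of_mem_hull (by
      rintro _ ⟨s, hs, rfl⟩
      rw [pair_toReal, hzero s hs]; simp) hx
    have h2 : 0 ≤ pair (-m) x := pair_nonneg_of_mem_hull (by
      rintro _ ⟨s, hs, rfl⟩
      rw [pair_toReal, LinearMap.neg_apply, hzero s hs]; simp) hx
    have h3 : pair (-m) x = -pair m x := by simp [pair]
    exact le_antisymm (by linarith) h1
  ext x
  have : pair m (toReal x) = 0 := hker (Submodule.mem_top (x := toReal x))
  rw [pair_toReal] at this
  exact_mod_cast this

/-- Every ray generator of a Gorenstein canonical cone is a vertex of each triangulation of the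
polytope it spans. -/
lemma IsGorensteinCanonical.singleton_mem_faces [Module.Free ℤ N]
    {σ : PointedCone ℝ (RealSpan N)}
    {m₀ : Module.Dual ℤ N} (hσ : IsGorensteinCanonical σ m₀)
    {K : Geometry.SimplicialComplex ℝ (RealSpan N)} (hK : K.space = rayPolytope σ) {v : N}
    (hv : v ∈ rayGenerators σ) : {toReal v} ∈ K.faces := by
  obtain ⟨m, hm, hface⟩ := hv.2.1
  have hvP : toReal v ∈ rayPolytope σ := subset_convexHull ℝ _ ⟨v, hv, rfl⟩
  rw [← hK, Geometry.SimplicialComplex.mem_space_iff] at hvP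
  obtain ⟨s, hs, hvs⟩ := hvP
  have hsub : ∀ y ∈ s, y ∈ rayPolytope σ := fun y hy => by
    rw [← hK]
    exact Geometry.SimplicialComplex.mem_space_iff.2 ⟨s, hs, subset_convexHull ℝ _ hy⟩
  have hraysσ : ∀ w ∈ rayGenerators σ, toReal w ∈ σ := fun w hw => by
    obtain ⟨m', -, h'⟩ := hw.2.1
    exact ((h' _).1 (Submodule.mem_span_singleton_self _)).1
  have hPσ : ∀ y ∈ rayPolytope σ, y ∈ σ := fun y hy =>
    convexHull_min (by
      rintro _ ⟨w, hw, rfl⟩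
      exact hraysσ w hw) σ.toConvexCone.convex hy
  have hP1 : ∀ y ∈ rayPolytope σ, pair m₀ y = 1 := fun y hy =>
    (convexHull_min (s := toReal '' rayGenerators σ) (t := {x | pair m₀ x = 1}) (by
      rintro _ ⟨w, hw, rfl⟩
      change pair m₀ (toReal w) = 1
      rw [pair_toReal, hσ.apply_rayGenerator w hw]; simp)
      (convex_hyperplane (Module.Dual.baseChange ℝ m₀).isLinear 1)) hy
  obtain ⟨w, hw0, hw1, hwv⟩ := Finset.mem_convexHull'.1 hvs
  have hmv : pair m (toReal v) = 0 := ((hface _).1 (Submodule.mem_span_singleton_self _)).2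
  -- The functional `m` is nonnegative on the polytope and zero at `v`, so a vertex of nonzero
  -- weight lies on the face cut out by `m`, the ray of `v`. Both points have height 1 under `m₀`,
  -- so that vertex is `v`.
  have hsum : ∑ y ∈ s, w y * pair m y = 0 := by
    have := congrArg (Module.Dual.baseChange ℝ m) hwv
    rw [map_sum] at this
    simp only [map_smul, smul_eq_mul] at this
    exact this.trans hmv
  obtain ⟨y, hy, hwy⟩ : ∃ y ∈ s, w y ≠ 0 := by
    by_contra! h
    rw [Finset.sum_eq_zero h] at hw1
    exact zero_ne_one hw1
  have h0 := (Finset.sum_eq_zero_iff_of_nonneg fun y hy =>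
    mul_nonneg (hw0 y hy) (hm y (hPσ y (hsub y hy)))).1 hsum y hy
  have hmy : pair m y = 0 := (mul_eq_zero.1 h0).resolve_left hwy
  obtain ⟨⟨a, ha⟩, hay⟩ := Submodule.mem_span_singleton.1
    ((hface y).2 ⟨hPσ y (hsub y hy), hmy⟩)
  replace hay : a • toReal v = y := hay
  have ha1 : a = 1 := by
    have h1 := hP1 y (hsub y hy)
    rw [← hay, pair_smul, pair_toReal, hσ.apply_rayGenerator v hv] at h1
    simpa using h1
  rw [ha1, one_smul] at hay
  rw [hay]
  exact K.down_closed hs (by simpa using hy) (by simp)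

end Rays


/-! ### Top-degree forms over a ring with `n` generating differentials -/

section Algebra

lemma exteriorPower_eq_smul_of_span {n : ℕ} {R M : Type*} [CommRing R] [AddCommGroup M] [Module R M]
    {v : Fin n → M} (hv : Submodule.span R (Set.range v) = ⊤) (ω : ⋀[R]^n M) :
    ∃ g : R, ω = g • exteriorPower.ιMulti R n v := by
  have h : ω ∈ Submodule.span R (Set.range (exteriorPower.ιMulti_family R n v)) := by
    rw [exteriorPower.ιMulti_family_span_of_span R hv]; trivial
  have hsub : Set.range (exteriorPower.ιMulti_family R n v) ⊆ {exteriorPower.ιMulti R n v} := by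
    rintro _ ⟨s, rfl⟩
    -- In top degree the generating family has a single member, as the only increasing self-map of
    -- `Fin n` is the identity.
    have hid : ∀ f : Fin n ↪o Fin n, (f : Fin n → Fin n) = id := fun f =>
      (f.strictMono.range_inj strictMono_id).1 (by
        rw [(Finite.injective_iff_surjective.1 f.injective).range_eq, Set.range_id])
    simp only [exteriorPower.ιMulti_family, hid, Function.comp_id, Set.mem_singleton_iff]
  obtain ⟨g, hg⟩ := Submodule.mem_span_singleton.1 (Submodule.span_mono hsub h)
  exact ⟨g, hg.symm⟩

/-- A non-unit lies in a maximal ideal, and in the fibre there `g` becomes zero. -/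
lemma isUnit_of_fibres_ne_zero {R W : Type} [CommRing R] [AddCommGroup W] [Module R W] {g : R}
    {w : W} (h : ∀ p : PrimeSpectrum R, (1 : p.asIdeal.ResidueField) ⊗ₜ[R] (g • w) ≠ 0) :
    IsUnit g := by
  by_contra hg
  obtain ⟨P, hP, hgP⟩ := exists_max_ideal_of_mem_nonunits hg
  refine h ⟨P, hP.isPrime⟩ ?_
  have hP' := hP.isPrime
  rw [← TensorProduct.smul_tmul, Algebra.smul_def,
    (Ideal.algebraMap_residueField_eq_zero (I := P)).2 hgP, zero_mul, TensorProduct.zero_tmul]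

lemma exists_isUnit_smul_wedgeD {n : ℕ} {R : Type} [CommRing R] [Algebra ℂ R] {f : Fin n → R}
    (hf : Submodule.span R (Set.range fun i => KaehlerDifferential.D ℂ R (f i)) = ⊤)
    (ω : AlgForm n R) (hω : ∀ p : PrimeSpectrum R, (1 : p.asIdeal.ResidueField) ⊗ₜ[R] ω ≠ 0) :
    ∃ g : R, IsUnit g ∧ ω = g • wedgeD f := by
  obtain ⟨g, hg⟩ := exteriorPower_eq_smul_of_span hf ω
  subst hg
  exact ⟨g, isUnit_of_fibres_ne_zero hω, rfl⟩

lemma span_D_of_surjective {ι A B : Type} [CommRing A] [CommRing B] [Algebra ℂ A] [Algebra ℂ B]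
    (φ : A →ₐ[ℂ] B) (hφ : Function.Surjective φ) {f : ι → A}
    (hf : Submodule.span A (Set.range fun i => KaehlerDifferential.D ℂ A (f i)) = ⊤) :
    Submodule.span B (Set.range fun i => KaehlerDifferential.D ℂ B (φ (f i))) = ⊤ := by
  let : Algebra A B := φ.toRingHom.toAlgebra
  have : IsScalarTower ℂ A B := IsScalarTower.of_algebraMap_eq fun x => (φ.commutes x).symm
  set W := Submodule.span B (Set.range fun i => KaehlerDifferential.D ℂ B (φ (f i)))
  have h1 : (⊤ : Submodule A (Ω[A⁄ℂ])) ≤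
      (W.restrictScalars A).comap (KaehlerDifferential.map ℂ ℂ A B) := by
    rw [← hf, Submodule.span_le]
    rintro _ ⟨i, rfl⟩
    change KaehlerDifferential.map ℂ ℂ A B (KaehlerDifferential.D ℂ A (f i)) ∈ W
    rw [KaehlerDifferential.map_D]
    exact Submodule.subset_span ⟨i, rfl⟩
  rw [← top_le_iff, ← KaehlerDifferential.span_range_derivation, Submodule.span_le]
  rintro _ ⟨x, rfl⟩
  obtain ⟨a, rfl⟩ := hφ x
  have := h1 (Submodule.mem_top (x := KaehlerDifferential.D ℂ A a))
  change KaehlerDifferential.map ℂ ℂ A B (KaehlerDifferential.D ℂ A a) ∈ W at this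
  rwa [KaehlerDifferential.map_D] at this

lemma AlgForm.map_smul_wedgeD {n : ℕ} {A B : Type} [CommRing A] [CommRing B] [Algebra ℂ A]
    [Algebra ℂ B] (φ : A →ₐ[ℂ] B) (g : A) (f : Fin n → A) :
    AlgForm.map n φ (g • wedgeD f) = φ g • wedgeD fun i => φ (f i) := by
  let : Algebra A B := φ.toRingHom.toAlgebra
  have : IsScalarTower ℂ A B := IsScalarTower.of_algebraMap_eq fun x => (φ.commutes x).symm
  simp only [AlgForm.map, wedgeD, LinearMap.toAddMonoidHom_coe]
  rw [map_smul, exteriorPower.alternatingMapLinearEquiv_apply_ιMulti, ← algebraMap_smul B g]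
  change φ g • exteriorPower.ιMulti B n (fun i => KaehlerDifferential.map ℂ ℂ A B _) = _
  congr 2
  funext i
  rw [KaehlerDifferential.map_D]
  rfl

end Algebra

/-! ### Differentials, vector fields and units of the coordinate rings -/

section Characters

variable {N : Type} [AddCommGroup N]

lemma single_eq_smul_chi {τ : PointedCone ℝ (RealSpan N)} (m : dualMonoid τ) (a : ℂ) :
    (AddMonoidAlgebra.single m a : CoordRing τ) = a • chi m := by
  simp [chi]

lemma chi_add {τ : PointedCone ℝ (RealSpan N)} (m m' : dualMonoid τ) :
    (chi (m + m') : CoordRing τ) = chi m * chi m' := by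
  simp [chi, AddMonoidAlgebra.single_mul_single]

lemma chi_zero {τ : PointedCone ℝ (RealSpan N)} : (chi 0 : CoordRing τ) = 1 := rfl

/-- The characters with differentials in a given submodule form a monoid. -/
def monoidOfD {τ : PointedCone ℝ (RealSpan N)} (W : Submodule (CoordRing τ) (Ω[CoordRing τ⁄ℂ])) :
    AddSubmonoid (dualMonoid τ) where
  carrier := {m | KaehlerDifferential.D ℂ (CoordRing τ) (chi m) ∈ W}
  zero_mem' := by
    change KaehlerDifferential.D ℂ (CoordRing τ) (chi 0) ∈ W
    rw [chi_zero, Derivation.map_one_eq_zero]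
    exact W.zero_mem
  add_mem' := by
    intro a b ha hb
    change KaehlerDifferential.D ℂ (CoordRing τ) (chi (a + b)) ∈ W
    rw [chi_add, Derivation.leibniz]
    exact W.add_mem (W.smul_mem _ hb) (W.smul_mem _ ha)

lemma mem_monoidOfD_of_add_eq_zero {τ : PointedCone ℝ (RealSpan N)}
    {W : Submodule (CoordRing τ) (Ω[CoordRing τ⁄ℂ])} {a b : dualMonoid τ} (h : a + b = 0)
    (ha : a ∈ monoidOfD W) : b ∈ monoidOfD W := by
  change KaehlerDifferential.D ℂ (CoordRing τ) (chi a) ∈ W at ha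
  change KaehlerDifferential.D ℂ (CoordRing τ) (chi b) ∈ W
  have h1 : (chi a * chi b : CoordRing τ) = 1 := by rw [← chi_add, h, chi_zero]
  have h2 := congrArg (KaehlerDifferential.D ℂ (CoordRing τ)) h1
  rw [Derivation.leibniz, Derivation.map_one_eq_zero] at h2
  -- Multiplying the Leibniz relation by `χ^b` isolates `dχ^b = -χ^{2b} dχ^a`.
  have h3 := congrArg ((chi b : CoordRing τ) • ·) h2
  simp only [smul_add, smul_zero, smul_smul] at h3
  rw [mul_comm, h1, one_smul] at h3
  rw [eq_neg_of_add_eq_zero_left h3]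
  exact W.neg_mem (W.smul_mem _ ha)

/-- Expand `m` in the dual basis. A negative coefficient can occur only at an index outside `J`,
where the coordinate is invertible in the monoid; closure under inverses covers that term. -/
lemma mem_of_coord_mem {n : ℕ} (b : Module.Basis (Fin n) ℤ N) {τ : PointedCone ℝ (RealSpan N)}
    (J : Set (Fin n)) (hτ : ∀ m, m ∈ dualMonoid τ ↔ ∀ j ∈ J, 0 ≤ m (b j))
    (hu : ∀ i, b.coord i ∈ dualMonoid τ) (T : AddSubmonoid (dualMonoid τ))
    (hneg : ∀ a b, a + b = 0 → a ∈ T → b ∈ T)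
    (hcoord : ∀ i, (⟨b.coord i, hu i⟩ : dualMonoid τ) ∈ T) (m : dualMonoid τ) : m ∈ T := by
  have hterm : ∀ i : Fin n, ∃ a : dualMonoid τ, a ∈ T ∧
      (a : Module.Dual ℤ N) = m.1 (b i) • b.coord i := by
    intro i
    rcases le_total 0 (m.1 (b i)) with h | h
    · refine ⟨(m.1 (b i)).toNat • ⟨b.coord i, hu i⟩, T.nsmul_mem (hcoord i) _, ?_⟩
      rw [AddSubmonoidClass.coe_nsmul, ← natCast_zsmul, Int.toNat_of_nonneg h]
    · have hmem : m.1 (b i) • b.coord i ∈ dualMonoid τ := by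
        refine (hτ _).2 fun j hj => ?_
        by_cases hij : j = i
        · subst hij
          simpa using (hτ _).1 m.2 j hj
        · simp [hij]
      refine ⟨⟨_, hmem⟩, hneg ((-m.1 (b i)).toNat • ⟨b.coord i, hu i⟩) _ ?_
        (T.nsmul_mem (hcoord i) _), rfl⟩
      apply Subtype.ext
      rw [AddSubmonoid.coe_add, AddSubmonoidClass.coe_nsmul, ← natCast_zsmul,
        Int.toNat_of_nonneg (by omega)]
      simp
  choose a ha ha' using hterm
  have : m = ∑ i, a i := by
    apply Subtype.ext
    rw [AddSubmonoid.coe_finsetSum, ← b.sum_dual_apply_smul_coord m.1]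
    exact Finset.sum_congr rfl fun i _ => (ha' i).symm
  rw [this]
  exact sum_mem fun i _ => ha i

/-- If `τ^∨ ∩ M` is cut out by the nonnegativity of some coordinates with respect to a basis, then
the differentials of the coordinate characters generate the differentials of `ℂ[τ^∨ ∩ M]`. -/
lemma span_D_chi {n : ℕ} (b : Module.Basis (Fin n) ℤ N) {τ : PointedCone ℝ (RealSpan N)}
    (J : Set (Fin n)) (hτ : ∀ m, m ∈ dualMonoid τ ↔ ∀ j ∈ J, 0 ≤ m (b j))
    (hu : ∀ i, b.coord i ∈ dualMonoid τ) :
    Submodule.span (CoordRing τ) (Set.range fun i =>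
      KaehlerDifferential.D ℂ (CoordRing τ) (chi ⟨b.coord i, hu i⟩)) = ⊤ := by
  set W := Submodule.span (CoordRing τ) (Set.range fun i =>
      KaehlerDifferential.D ℂ (CoordRing τ) (chi ⟨b.coord i, hu i⟩))
  have hall := mem_of_coord_mem b J hτ hu (monoidOfD W)
    (fun _ _ h ha => mem_monoidOfD_of_add_eq_zero h ha) fun i => Submodule.subset_span ⟨i, rfl⟩
  rw [← top_le_iff, ← KaehlerDifferential.span_range_derivation, Submodule.span_le]
  rintro _ ⟨x, rfl⟩
  induction x using AddMonoidAlgebra.induction_linear with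
  | zero => rw [map_zero]; exact W.zero_mem
  | add f g hf hg => rw [map_add]; exact W.add_mem hf hg
  | single m c =>
    rw [single_eq_smul_chi, Derivation.map_smul]
    exact Submodule.smul_of_tower_mem W c (hall m)

/-- The linear map `χ^m ↦ ⟨m, x⟩ χ^m`. -/
def charScale (τ : PointedCone ℝ (RealSpan N)) (x : N) : CoordRing τ →ₗ[ℂ] CoordRing τ :=
  (Finsupp.lsum ℂ fun m : dualMonoid τ =>
    (m.1 x : ℂ) • AddMonoidAlgebra.lsingle (R := ℂ) (S := ℂ) m).comp
      (AddMonoidAlgebra.coeffLinearEquiv ℂ).toLinearMap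

lemma charScale_single {τ : PointedCone ℝ (RealSpan N)} (x : N) (m : dualMonoid τ) (c : ℂ) :
    charScale τ x (AddMonoidAlgebra.single m c) = AddMonoidAlgebra.single m (m.1 x * c) := by
  simp [charScale]

/-- The derivation `χ^m ↦ ⟨m, x⟩ χ^m`. -/
def charDerivation (τ : PointedCone ℝ (RealSpan N)) (x : N) :
    Derivation ℂ (CoordRing τ) (CoordRing τ) :=
  Derivation.mk' (charScale τ x) (by
    intro f g
    induction f using AddMonoidAlgebra.induction_linear with
    | zero => simp
    | add f₁ f₂ h₁ h₂ => rw [add_mul, map_add, h₁, h₂, map_add]; simp only [smul_eq_mul]; ring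
    | single m c =>
      induction g using AddMonoidAlgebra.induction_linear with
      | zero => simp
      | add f₁ f₂ h₁ h₂ => rw [mul_add, map_add, h₁, h₂, map_add]; simp only [smul_eq_mul]; ring
      | single m' c' =>
        rw [smul_eq_mul, smul_eq_mul, AddMonoidAlgebra.single_mul_single, charScale_single,
          charScale_single, charScale_single, AddMonoidAlgebra.single_mul_single,
          AddMonoidAlgebra.single_mul_single, add_comm m' m, ← AddMonoidAlgebra.single_add]
        congr 1
        rw [AddSubmonoid.coe_add, LinearMap.add_apply]
        push_cast
        ring)

lemma charDerivation_chi {τ : PointedCone ℝ (RealSpan N)} (x : N) (m : dualMonoid τ) :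
    charDerivation τ x (chi m) = chi m * algebraMap ℂ (CoordRing τ) (m.1 x : ℂ) := by
  change charScale τ x (AddMonoidAlgebra.single m 1) = _
  rw [charScale_single, mul_one, mul_comm, ← Algebra.smul_def, ← single_eq_smul_chi]

/-- Contraction of an `n`-form with the vector fields `χ^m ↦ ⟨m, x i⟩ χ^m`. -/
def contraction {n : ℕ} (τ : PointedCone ℝ (RealSpan N)) (x : Fin n → N) :
    AlgForm n (CoordRing τ) →ₗ[CoordRing τ] CoordRing τ :=
  exteriorPower.alternatingMapLinearEquiv (Matrix.detRowAlternating.compLinearMap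
    (LinearMap.pi fun j => (charDerivation τ (x j)).liftKaehlerDifferential))

/-- The matrix of contractions has entries `χ^{u_i} ⟨u_i, x_j⟩`; the characters come out of the rows
and multiply to the character of the sum. -/
lemma contraction_wedgeD_chi {n : ℕ} {τ : PointedCone ℝ (RealSpan N)} (x : Fin n → N)
    (u : Fin n → dualMonoid τ) :
    contraction τ x (wedgeD fun i => chi (u i)) = chi (∑ i, u i) *
      algebraMap ℂ (CoordRing τ) ((Matrix.of fun i j => (u i).1 (x j)).det : ℤ) := by
  have hchi : ∀ s : Finset (Fin n), (chi (∑ i ∈ s, u i) : CoordRing τ) = ∏ i ∈ s, chi (u i) := by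
    classical
    intro s
    induction s using Finset.induction_on with
    | empty => rfl
    | insert i s hi ih => rw [Finset.sum_insert hi, Finset.prod_insert hi, chi_add, ih]
  rw [contraction, wedgeD, exteriorPower.alternatingMapLinearEquiv_apply_ιMulti, hchi]
  change Matrix.det _ = _
  have h1 : ((algebraMap ℂ (CoordRing τ)) ((Matrix.of fun i j => (u i).1 (x j)).det : ℤ)) =
      (Matrix.of fun i j => algebraMap ℂ (CoordRing τ) ((u i).1 (x j) : ℂ)).det := by
    rw [← eq_intCast (Int.castRingHom ℂ), RingHom.map_det, RingHom.map_det]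
    rfl
  rw [h1, ← Matrix.det_mul_column]
  congr 1
  ext1 i j
  simp only [Matrix.of_apply, LinearMap.pi_apply, Derivation.liftKaehlerDifferential_comp_D,
    charDerivation_chi]

/-- The units of `ℂ[τ^∨ ∩ M]` are the nonzero multiples of characters. -/
lemma exists_eq_single_of_isUnit {n : ℕ} (e : Module.Basis (Fin n) ℤ N)
    {τ : PointedCone ℝ (RealSpan N)} {g : CoordRing τ} (hg : IsUnit g) :
    ∃ (k : dualMonoid τ) (c : ℂ), c ≠ 0 ∧ g = AddMonoidAlgebra.single k c := by
  -- This property is inherited from `ℤ^n`. If one of two factors has several terms, two different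
  -- pairs of exponents contribute uncancelled terms to the product. When the product is 1, both
  -- pairs sum to zero, contradicting uniqueness.
  have : TwoUniqueSums (dualMonoid τ) := by
    let ψ : dualMonoid τ →ₙ+ (Fin n → ℤ) :=
      { toFun := fun m i => m.1 (e i)
        map_add' := fun a b => by ext i; rfl }
    refine TwoUniqueSums.of_injective_addHom ψ (fun a b hab => Subtype.ext ?_) inferInstance
    exact e.ext fun i => congrFun hab i
  obtain ⟨h, hgh⟩ := hg.exists_right_inv
  have hg0 : g ≠ 0 := hg.ne_zero
  have hh0 : h ≠ 0 := by
    rintro rfl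
    simp at hgh
  have hcg : 0 < g.coeff.support.card := by
    rw [Finset.card_pos, Finsupp.support_nonempty_iff]
    simpa using hg0
  have hch : 0 < h.coeff.support.card := by
    rw [Finset.card_pos, Finsupp.support_nonempty_iff]
    simpa using hh0
  have hcard : g.coeff.support.card = 1 := by
    by_contra hne
    have hlt : 1 < g.coeff.support.card * h.coeff.support.card := by
      have : 2 ≤ g.coeff.support.card := by omega
      nlinarith
    obtain ⟨p, hp, q, hq, hpq, hup, huq⟩ := TwoUniqueSums.uniqueAdd_of_one_lt_card hlt
    have key : ∀ r ∈ g.coeff.support ×ˢ h.coeff.support,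
        UniqueAdd g.coeff.support h.coeff.support r.1 r.2 → r.1 + r.2 = 0 := by
      intro r hr hu
      have h1 := AddMonoidAlgebra.coeff_mul_add_of_uniqueAdd hu
      rw [Finset.mem_product, Finsupp.mem_support_iff, Finsupp.mem_support_iff] at hr
      rw [hgh, AddMonoidAlgebra.one_def, AddMonoidAlgebra.coeff_single] at h1
      by_contra hne
      rw [Finsupp.single_eq_of_ne (by simpa using hne)] at h1
      exact mul_ne_zero hr.1 hr.2 h1.symm
    have h1 := hup (Finset.mem_product.1 hq).1 (Finset.mem_product.1 hq).2
      ((key q hq huq).trans (key p hp hup).symm)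
    exact hpq (Prod.ext h1.1.symm h1.2.symm)
  obtain ⟨k, c, hc, hk⟩ := Finsupp.card_support_eq_one'.1 hcard
  exact ⟨k, c, hc, AddMonoidAlgebra.coeff_injective (by rw [hk, AddMonoidAlgebra.coeff_single])⟩

end Characters


/-! ### Sections of a scheme read on affine charts -/

section Schemes

lemma appLE_Spec_map_top {R S : CommRingCat.{0}} (φ : R ⟶ S) (e : ⊤ ≤ Spec.map φ ⁻¹ᵁ ⊤) :
    (Spec.map φ).appLE ⊤ ⊤ e ≫ (Scheme.ΓSpecIso S).hom = (Scheme.ΓSpecIso R).hom ≫ φ := by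
  have h : (Spec.map φ).appLE ⊤ ⊤ e = (Spec.map φ).appTop := Scheme.Hom.appLE_eq_app _
  rw [h, Scheme.ΓSpecIso_naturality]

lemma appLE_congr_hom {X Y : Scheme.{0}} {f g : X ⟶ Y} (h : f = g) (U : Y.Opens) (V : X.Opens)
    (e : V ≤ f ⁻¹ᵁ U) : f.appLE U V e = g.appLE U V (h ▸ e) := by
  subst h; rfl

lemma appLE_appLE_ΓSpecIso {Y : Scheme.{0}} {R A : CommRingCat.{0}} (g : Y ⟶ Spec R)
    (f : Spec A ⟶ Y) (φ : R ⟶ A) (h : f ≫ g = Spec.map φ) (U : Y.Opens) (e₁ : U ≤ g ⁻¹ᵁ ⊤)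
    (e : ⊤ ≤ f ⁻¹ᵁ U) :
    ((Scheme.ΓSpecIso R).inv ≫ g.appLE ⊤ U e₁) ≫ f.appLE U ⊤ e ≫ (Scheme.ΓSpecIso A).hom = φ := by
  rw [Category.assoc, Scheme.Hom.appLE_comp_appLE_assoc, appLE_congr_hom h, appLE_Spec_map_top,
    Iso.inv_hom_id_assoc]

lemma map_appLE_ΓSpecIso {Y : Scheme.{0}} {A B : CommRingCat.{0}} (f : Spec A ⟶ Y)
    (f' : Spec B ⟶ Y) (φ : A ⟶ B) (h : Spec.map φ ≫ f = f') {U V : Y.Opens} (i : V ≤ U)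
    (e : ⊤ ≤ f ⁻¹ᵁ U) (e' : ⊤ ≤ f' ⁻¹ᵁ V) :
    Y.presheaf.map (homOfLE i).op ≫ f'.appLE V ⊤ e' ≫ (Scheme.ΓSpecIso B).hom =
      (f.appLE U ⊤ e ≫ (Scheme.ΓSpecIso A).hom) ≫ φ := by
  have e'' : ⊤ ≤ Spec.map φ ⁻¹ᵁ ⊤ := le_top
  rw [Scheme.Hom.map_appLE_assoc, Category.assoc, ← appLE_Spec_map_top φ e'',
    Scheme.Hom.appLE_comp_appLE_assoc, appLE_congr_hom h]

end Schemes

/-! ### Charts of the toric variety and their functions -/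

section Charts

variable {N : Type} [AddCommGroup N] (Δ : Fan N)

/-- The affine open subset of `Y_Δ` belonging to a cone. -/
def Fan.chartOpen (τ : Δ.cones) : Δ.toricVariety.left.affineOpens :=
  ⟨Δ.chart τ ''ᵁ ⊤, (isAffineOpen_top _).image_of_isOpenImmersion _⟩

lemma Fan.diagram_map_chart {τ σ : Δ.cones} (f : τ ⟶ σ) :
    Δ.diagram.map f ≫ Δ.chart σ = Δ.chart τ :=
  colimit.w Δ.diagram f

lemma Fan.chart_hom (τ : Δ.cones) :
    Δ.chart τ ≫ Δ.toricVariety.hom =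
      Spec.map (CommRingCat.ofHom (algebraMap ℂ (CoordRing τ.1))) :=
  colimit.ι_desc Δ.diagramCocone τ

/-- The regular functions on the chart of a cone. -/
def Fan.sectionsIso (τ : Δ.cones) :
    Γ(Δ.toricVariety.left, (Δ.chartOpen τ).1) ≅ CommRingCat.of (CoordRing τ.1) :=
  (Δ.chart τ).appIso ⊤ ≪≫ Scheme.ΓSpecIso _

lemma Fan.sectionsIso_hom (τ : Δ.cones) : (Δ.sectionsIso τ).hom =
    (Δ.chart τ).appLE (Δ.chartOpen τ).1 ⊤ ((Δ.chart τ).preimage_image_eq ⊤).ge ≫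
      (Scheme.ΓSpecIso _).hom := by
  change ((Δ.chart τ).appIso ⊤).hom ≫ _ = _
  rw [Scheme.Hom.appIso_hom']
  rfl

lemma Fan.algebraMap_sectionsIso (τ : Δ.cones) (c : ℂ) :
    (Δ.sectionsIso τ).hom (algebraMap ℂ Γ(Δ.toricVariety.left, (Δ.chartOpen τ).1) c) =
      algebraMap ℂ (CoordRing τ.1) c := by
  have h : ((Scheme.ΓSpecIso (CommRingCat.of ℂ)).inv ≫ Δ.toricVariety.hom.appLE ⊤
      (Δ.chartOpen τ).1 (le_preimage_top _ _)) ≫ (Δ.sectionsIso τ).hom =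
        CommRingCat.ofHom (algebraMap ℂ (CoordRing τ.1)) := by
    rw [Fan.sectionsIso_hom]
    exact appLE_appLE_ΓSpecIso _ _ _ (Δ.chart_hom τ) _ _ _
  exact congrArg (fun φ => φ.hom c) h

/-- The regular functions on the chart of a cone, as a `ℂ`-algebra. -/
def Fan.sectionsEquiv (τ : Δ.cones) :
    Γ(Δ.toricVariety.left, (Δ.chartOpen τ).1) ≃ₐ[ℂ] CoordRing τ.1 :=
  AlgEquiv.ofRingEquiv (f := (Δ.sectionsIso τ).commRingCatIsoToRingEquiv)
    (Δ.algebraMap_sectionsIso τ)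

lemma Fan.chartOpen_mono {τ σ : Δ.cones} (h : τ ≤ σ) :
    (Δ.chartOpen τ).1 ≤ (Δ.chartOpen σ).1 := by
  rintro _ ⟨x, -, rfl⟩
  refine ⟨Δ.diagram.map (homOfLE h) x, trivial, ?_⟩
  have := congrArg (fun f : Spec (CommRingCat.of (CoordRing τ.1)) ⟶ Δ.toricVariety.left => f x)
    (Δ.diagram_map_chart (homOfLE h))
  exact (Scheme.Hom.comp_apply _ _ x).symm.trans this

lemma Fan.sectionsEquiv_res {τ σ : Δ.cones} (h : τ ≤ σ)
    (x : Γ(Δ.toricVariety.left, (Δ.chartOpen σ).1)) :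
    Δ.sectionsEquiv τ (resAlgHom Δ.toricVariety (Δ.chartOpen_mono h) x) =
      coordMap h (Δ.sectionsEquiv σ x) := by
  have hres : Δ.toricVariety.left.presheaf.map (homOfLE (Δ.chartOpen_mono h)).op ≫
      (Δ.sectionsIso τ).hom = (Δ.sectionsIso σ).hom ≫
        CommRingCat.ofHom (coordMap h).toRingHom := by
    rw [Fan.sectionsIso_hom, Fan.sectionsIso_hom]
    exact map_appLE_ΓSpecIso _ _ _ (Δ.diagram_map_chart (homOfLE h)) _ _ _
  exact congrArg (fun φ => φ.hom x) hres

end Charts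


/-! ### Regular forms on charts and their restriction to the torus -/

section Forms

variable {N : Type} [AddCommGroup N] {Δ : Fan N}

/-- The set `J` allows one statement for both charts in use: `∅` for the torus and a singleton for a
ray. The coordinate differentials generate, and nonvanishing in every fibre makes the coefficient a
unit. -/
lemma RegularForm.exists_form_chart {n : ℕ} (Ω : RegularForm Δ.toricVariety n)
    (hΩ : Ω.NowhereVanishing) (b : Module.Basis (Fin n) ℤ N) (τ : Δ.cones)
    (J : Set (Fin n)) (hτ : ∀ m, m ∈ dualMonoid τ.1 ↔ ∀ j ∈ J, 0 ≤ m (b j))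
    (hu : ∀ i, b.coord i ∈ dualMonoid τ.1) :
    ∃ a : CoordRing τ.1, IsUnit a ∧ Ω.form (Δ.chartOpen τ) =
      (Δ.sectionsEquiv τ).symm a •
        wedgeD fun i => (Δ.sectionsEquiv τ).symm (chi ⟨b.coord i, hu i⟩) := by
  obtain ⟨g, hg, hω⟩ := exists_isUnit_smul_wedgeD
    (span_D_of_surjective (Δ.sectionsEquiv τ).symm.toAlgHom (Δ.sectionsEquiv τ).symm.surjective
      (span_D_chi b J hτ hu)) (Ω.form (Δ.chartOpen τ)) (hΩ _)
  refine ⟨Δ.sectionsEquiv τ g, hg.map _, ?_⟩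
  rw [AlgEquiv.symm_apply_apply]
  exact hω

lemma RegularForm.map_form_chartOpen_zeroCone {n : ℕ} (Ω : RegularForm Δ.toricVariety n)
    {τ : Δ.cones} {a : CoordRing τ.1} {u : Fin n → dualMonoid τ.1}
    (h : Ω.form (Δ.chartOpen τ) =
      (Δ.sectionsEquiv τ).symm a • wedgeD fun i => (Δ.sectionsEquiv τ).symm (chi (u i))) :
    AlgForm.map n (Δ.sectionsEquiv Δ.zeroCone).toAlgHom (Ω.form (Δ.chartOpen Δ.zeroCone)) =
      coordMap (bot_le : ⊥ ≤ τ.1) a •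
        wedgeD fun i => chi ⟨(u i).1, mem_dualMonoid_bot (u i).1⟩ := by
  have hle : Δ.zeroCone ≤ τ := (bot_le : ⊥ ≤ τ.1)
  have hres := Ω.res (Δ.chartOpen τ) (Δ.chartOpen Δ.zeroCone) (Δ.chartOpen_mono hle)
  rw [h, AlgForm.map_smul_wedgeD] at hres
  rw [← hres, AlgForm.map_smul_wedgeD]
  have key : ∀ x : CoordRing τ.1, (Δ.sectionsEquiv Δ.zeroCone).toAlgHom
      (resAlgHom Δ.toricVariety (Δ.chartOpen_mono hle) ((Δ.sectionsEquiv τ).symm x)) =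
      coordMap (bot_le : ⊥ ≤ τ.1) x := by
    intro x
    refine (Δ.sectionsEquiv_res hle _).trans ?_
    rw [AlgEquiv.apply_symm_apply]
    rfl
  refine congrArg₂ (· • ·) (key a) (congrArg wedgeD (funext fun i => ?_))
  refine (key _).trans ?_
  rw [coordMap_chi]
  rfl

/-- The inverse of `a` is also a monomial, with exponent `-k`; both exponents are nonnegative on
`v`. -/
lemma eq_zero_of_isUnit_single {v : N} {a : CoordRing (PointedCone.hull ℝ {toReal v})} {n : ℕ}
    (e : Module.Basis (Fin n) ℤ N) (ha : IsUnit a) {k : dualMonoid (PointedCone.hull ℝ {toReal v})}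
    {c : ℂ} (hc : c ≠ 0) (hk : a = AddMonoidAlgebra.single k c) : k.1 v = 0 := by
  obtain ⟨h, hah⟩ := ha.exists_right_inv
  obtain ⟨l, d, hd, hl⟩ := exists_eq_single_of_isUnit e (IsUnit.of_mul_eq_one_right a hah)
  rw [hk, hl, AddMonoidAlgebra.single_mul_single, AddMonoidAlgebra.one_def,
    ← AddMonoidAlgebra.coeff_inj, AddMonoidAlgebra.coeff_single, AddMonoidAlgebra.coeff_single,
    Finsupp.single_eq_single_iff] at hah
  have hkl : k + l = 0 := (hah.resolve_right fun h => mul_ne_zero hc hd h.1).1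
  have h1 := mem_dualMonoid_hull_singleton.1 k.2
  have h2 := mem_dualMonoid_hull_singleton.1 l.2
  have h3 := congrArg (fun m => m.1 v) hkl
  change k.1 v + l.1 v = 0 at h3
  omega

/-- Contraction with the fields of `e` turns both sides into monomials. The left determinant is 1,
so the left coefficient is `c ≠ 0` and the exponents must agree, whatever the determinant on the
right. -/
lemma exponents_eq_of_smul_wedgeD_eq {n : ℕ} (e : Module.Basis (Fin n) ℤ N)
    {τ : PointedCone ℝ (RealSpan N)} {u w : Fin n → dualMonoid τ} (hu : ∀ i, (u i).1 = e.coord i) {k l : dualMonoid τ} {c d : ℂ}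
    (hc : c ≠ 0)
    (h : (AddMonoidAlgebra.single k c : CoordRing τ) • wedgeD (fun i => chi (u i)) =
      (AddMonoidAlgebra.single l d : CoordRing τ) • wedgeD (fun i => chi (w i))) :
    k.1 + ∑ i, (u i).1 = l.1 + ∑ i, (w i).1 := by
  have h1 := congrArg (contraction τ e) h
  have hdet : (Matrix.of fun i j => (u i).1 (e j)).det = 1 := by
    have : (Matrix.of fun i j => (u i).1 (e j)) = (1 : Matrix (Fin n) (Fin n) ℤ) := by
      ext i j
      simp [hu, Matrix.one_apply, Finsupp.single_apply, eq_comm]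
    rw [this, Matrix.det_one]
  rw [map_smul, map_smul, contraction_wedgeD_chi, contraction_wedgeD_chi, hdet, Int.cast_one,
    map_one, mul_one, smul_eq_mul, smul_eq_mul, mul_comm (chi _), ← Algebra.smul_def,
    AddMonoidAlgebra.smul_single, AddMonoidAlgebra.single_mul_single,
    AddMonoidAlgebra.single_mul_single, ← AddMonoidAlgebra.coeff_inj,
    AddMonoidAlgebra.coeff_single, AddMonoidAlgebra.coeff_single,
    Finsupp.single_eq_single_iff] at h1
  have h2 := congrArg Subtype.val (h1.resolve_right fun h => hc (by simpa using h.1)).1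
  simpa only [AddSubmonoid.coe_add, AddSubmonoid.coe_finsetSum] using h2

end Forms

end Toric

end

/-! ### Comparison of the torus with the charts of the rays -/

theorem proposition2p1 {N : Type} [AddCommGroup N] [Module.Free ℤ N] [Module.Finite ℤ N]
    (σ : PointedCone ℝ (Toric.RealSpan N)) (m₀ : Module.Dual ℤ N)
    (hσ : Toric.IsGorensteinCanonical σ m₀)
    (hfull : Submodule.span ℝ (σ : Set (Toric.RealSpan N)) = ⊤)
    (K : Geometry.SimplicialComplex ℝ (Toric.RealSpan N))
    (hK : K.space = Toric.rayPolytope σ)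
    (Δ : Toric.Fan N) (hΔ : Δ.IsConeOver K)
    (hsmooth : Smooth Δ.toricVariety.hom)
    {n : ℕ} (e : Module.Basis (Fin n) ℤ N) (he : m₀ = ∑ i, e.coord i)
    (Ω : Toric.RegularForm Δ.toricVariety n) (hΩ : Ω.NowhereVanishing) :
    ∃ C : ℂ, Ω.form Δ.torus = C • Toric.wedgeD fun i => Δ.character (e.coord i) := by
  obtain ⟨a, ha, hω⟩ := Ω.exists_form_chart hΩ e Δ.zeroCone ∅
    (fun m => ⟨fun _ _ hj => hj.elim, fun _ => Toric.mem_dualMonoid_bot m⟩)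
    fun i => Toric.mem_dualMonoid_bot _
  have hpull := Ω.map_form_chartOpen_zeroCone hω
  rw [show Toric.coordMap (bot_le : ⊥ ≤ Δ.zeroCone.1) a = a from Toric.coordMap_self _ a] at hpull
  obtain ⟨k, c, hc, rfl⟩ := Toric.exists_eq_single_of_isUnit e ha
  have hk : k.1 = 0 := by
    refine hσ.eq_zero_of_rayGenerators e hfull fun v hv => ?_
    obtain ⟨b, i₀, hb⟩ := Toric.exists_basis_of_primitive e (Toric.rayGenerator_primitive hv)
    have hmem : PointedCone.hull ℝ {Toric.toReal v} ∈ Δ.cones := by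
      rw [show Δ.cones = _ from hΔ]
      exact Or.inr ⟨_, hσ.singleton_mem_faces hK hv, by simp⟩
    obtain ⟨a', ha', hω'⟩ := Ω.exists_form_chart hΩ b ⟨_, hmem⟩ {i₀}
      (fun m => by
        rw [Toric.mem_dualMonoid_hull_singleton]
        simp [hb])
      fun i => by
        rw [Toric.mem_dualMonoid_hull_singleton, ← hb]
        by_cases h : i = i₀ <;> simp [h]
    have hpull' := Ω.map_form_chartOpen_zeroCone hω'
    obtain ⟨k', c', hc', rfl⟩ := Toric.exists_eq_single_of_isUnit e ha'
    have hk' := Toric.eq_zero_of_isUnit_single e ha' hc' rfl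
    -- Two expressions for the same form on the torus, one from the basis `e` and one restricted
    -- from the chart of the ray of `v`.
    rw [hpull] at hpull'
    rw [Toric.coordMap, AddMonoidAlgebra.mapDomainAlgHom_apply,
      AddMonoidAlgebra.mapDomain_single] at hpull'
    have h := congrArg (fun m : Module.Dual ℤ N => m v)
      (Toric.exponents_eq_of_smul_wedgeD_eq e (fun i => rfl) hc hpull')
    have hb1 : (∑ i, b.coord i) v = 1 := by
      rw [LinearMap.sum_apply, ← hb, Finset.sum_eq_single i₀] <;> simp +contextual
    have h' : k.1 v + (∑ i, e.coord i) v = k'.1 v + (∑ i, b.coord i) v := h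
    rw [← he, hσ.apply_rayGenerator v hv, hk', hb1] at h'
    omega
  have hk0 : k = 0 := Subtype.ext hk
  subst hk0
  refine ⟨c, hω.trans ?_⟩
  have hc' : (AddMonoidAlgebra.single 0 c : Toric.CoordRing Δ.zeroCone.1) = algebraMap ℂ _ c := by
    rw [Toric.single_eq_smul_chi, Toric.chi_zero, Algebra.algebraMap_eq_smul_one]
  rw [hc', AlgEquiv.commutes, algebraMap_smul]
  rfl
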